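/- Let $n\ge 1$ and let $\Psi:M_n(\mathbb R)\to M_n(\mathbb R)$ be a linear map that is unital ($\Psi(I_n)=I_n$), idempotent ($\Psi\circ\Psi=\Psi$) and IPT. Here $\Psi$ is called IPT (invariant under partial transpose) if it is completely positive (for every $p$, the map $\Psi\otimes\mathrm{id}_p$ commutes with the transpose and maps positive semidefinite matrices to positive semidefinite matrices) and its Choi matrix $C_\Psi=\sum_{i,j}E_{ij}\otimes\Psi(E_{ij})$ is positive semidefinite and satisfies $(\tau_n\otimes\mathrm{id}_n)(C_\Psi)=C_\Psi$, where $\tau_n$ is the transpose map on $M_n(\mathbb R)$. Then: 1. The operator system $\mathcal R:=\Psi(M_n(\mathbb R))\subseteq M_n(\mathbb R)$ with the Choi--Effros product $A\star B:=\Psi(AB)$ is order isomorphic to $\ell^\infty_k(\mathbb R)$ for some $k\ge 1$; that is, there is a linear bijection $\theta:\mathcal R\to\ell^\infty_k(\mathbb R)$ with $\theta(I_n)=1$, $\theta(A\star B)=\theta(A)\theta(B)$ and $\theta(A^t)=\theta(A)^*$ for all $A,B\in\mathcal R$, such that $A\in\mathcal R$ is positive semidefinite if and only if $\theta(A)\ge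 0$; moreover, $\theta$ is a complete order isomorphism: for every $r$, a matrix $(X_{ij})\in M_r(\mathcal R)$ is positive semidefinite in $M_r(M_n(\mathbb R))$ if and only if $(\theta(X_{ij}))$ is positive in $M_r(\ell^\infty_k(\mathbb R))$. 2. $\Psi$ is $\mathbb R$-entanglement breaking: for every $r\ge 1$ and every positive semidefinite $P\in M_n(\mathbb R)\otimes M_r(\mathbb R)$ there are finitely many positive semidefinite $A_i\in M_n(\mathbb R)$ and $B_i\in M_r(\mathbb R)$ with $(\Psi\otimes\mathrm{id}_r)(P)=\sum_i A_i\otimes B_i$. -/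

import Mathlib

open scoped Kronecker

namespace RealQuantum

/-- The linear map `Φ ⊗ id_r : M_n(ℝ) ⊗ M_r(ℝ) → M_m(ℝ) ⊗ M_r(ℝ)`, where `M_n(ℝ) ⊗ M_r(ℝ)` is
identified with the matrices indexed by `Fin n × Fin r` through the Kronecker product: `Φ` is applied
to each of the `r²` blocks `(P (a, i) (b, j))_{a, b}`. -/
def tensorId {n m : ℕ} (Φ : Matrix (Fin n) (Fin n) ℝ →ₗ[ℝ] Matrix (Fin m) (Fin m) ℝ) (r : ℕ) :
    Matrix (Fin n × Fin r) (Fin n × Fin r) ℝ →ₗ[ℝ] Matrix (Fin m × Fin r) (Fin m × Fin r) ℝ where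
  toFun P := Matrix.of fun x y => Φ (Matrix.of fun a b => P (a, x.2) (b, y.2)) x.1 y.1
  map_add' P Q := by
    ext x y
    exact congrFun (congrFun (Φ.map_add (Matrix.of fun a b => P (a, x.2) (b, y.2))
      (Matrix.of fun a b => Q (a, x.2) (b, y.2))) x.1) y.1
  map_smul' c P := by
    ext x y
    exact congrFun (congrFun (Φ.map_smul c (Matrix.of fun a b => P (a, x.2) (b, y.2))) x.1) y.1

/-- `tensorId Φ r` is the map `Φ ⊗ id_r`: it sends `A ⊗ B` to `Φ(A) ⊗ B`. -/
theorem tensorId_kronecker {n m : ℕ}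
    (Φ : Matrix (Fin n) (Fin n) ℝ →ₗ[ℝ] Matrix (Fin m) (Fin m) ℝ) (r : ℕ)
    (A : Matrix (Fin n) (Fin n) ℝ) (B : Matrix (Fin r) (Fin r) ℝ) :
    tensorId Φ r (A ⊗ₖ B) = Φ A ⊗ₖ B := by
  ext x y
  have h : (Matrix.of fun a b => (A ⊗ₖ B) (a, x.2) (b, y.2)) = B x.2 y.2 • A := by
    ext a b
    simp [Matrix.kroneckerMap_apply, mul_comm]
  change Φ (Matrix.of fun a b => (A ⊗ₖ B) (a, x.2) (b, y.2)) x.1 y.1 = _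
  rw [h, map_smul]
  simp [Matrix.kroneckerMap_apply, mul_comm]

/-- A linear map between real matrix spaces is positive if it preserves positive semidefiniteness
and commutes with the adjoint, i.e. with the transpose. -/
def IsPositiveMap {ι κ : Type*} (Φ : Matrix ι ι ℝ →ₗ[ℝ] Matrix κ κ ℝ) : Prop :=
  (∀ P : Matrix ι ι ℝ, P.PosSemidef → (Φ P).PosSemidef) ∧
    ∀ A : Matrix ι ι ℝ, Φ A.transpose = (Φ A).transpose

/-- `Φ` is completely positive if `Φ ⊗ id_p` is positive for every `p`. -/
def IsCompletelyPositive {n m : ℕ}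
    (Φ : Matrix (Fin n) (Fin n) ℝ →ₗ[ℝ] Matrix (Fin m) (Fin m) ℝ) : Prop :=
  ∀ p : ℕ, IsPositiveMap (tensorId Φ p)

/-- The Choi matrix `C_Φ = ∑_{i,j} E_{ij} ⊗ Φ(E_{ij})`. -/
def choiMatrix {n m : ℕ} (Φ : Matrix (Fin n) (Fin n) ℝ →ₗ[ℝ] Matrix (Fin m) (Fin m) ℝ) :
    Matrix (Fin n × Fin m) (Fin n × Fin m) ℝ :=
  ∑ i, ∑ j, Matrix.single i j (1 : ℝ) ⊗ₖ Φ (Matrix.single i j 1)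

/-- The partial transpose `τ_n ⊗ id_m`. -/
def partialTranspose (n m : ℕ) :
    Matrix (Fin n × Fin m) (Fin n × Fin m) ℝ →ₗ[ℝ] Matrix (Fin n × Fin m) (Fin n × Fin m) ℝ :=
  tensorId (Matrix.transposeLinearEquiv (Fin n) (Fin n) ℝ ℝ).toLinearMap m

/-- A positive matrix is IPT if it is invariant under partial transpose. -/
def IsIPTMatrix {n m : ℕ} (P : Matrix (Fin n × Fin m) (Fin n × Fin m) ℝ) : Prop :=
  P.PosSemidef ∧ partialTranspose n m P = P

/-- A map is IPT if it is completely positive and its Choi matrix is IPT. -/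
def IsIPTMap {n m : ℕ} (Φ : Matrix (Fin n) (Fin n) ℝ →ₗ[ℝ] Matrix (Fin m) (Fin m) ℝ) : Prop :=
  IsCompletelyPositive Φ ∧ IsIPTMatrix (choiMatrix Φ)

/-- The cone `SEP(ℝ^n ⊗ ℝ^m)` of finite sums `∑ A_i ⊗ B_i` with `A_i`, `B_i` real positive
semidefinite. -/
def SEP (n m : ℕ) : Set (Matrix (Fin n × Fin m) (Fin n × Fin m) ℝ) :=
  {P | ∃ (N : ℕ) (A : Fin N → Matrix (Fin n) (Fin n) ℝ) (B : Fin N → Matrix (Fin m) (Fin m) ℝ),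
    (∀ i, (A i).PosSemidef) ∧ (∀ i, (B i).PosSemidef) ∧ P = ∑ i, A i ⊗ₖ B i}

/-- `Φ` is `ℝ`-entanglement breaking: `(Φ ⊗ id_r)(P)` is `ℝ`-separable for every `r ≥ 1` and every
positive semidefinite `P`. -/
def IsEntanglementBreaking {n m : ℕ}
    (Φ : Matrix (Fin n) (Fin n) ℝ →ₗ[ℝ] Matrix (Fin m) (Fin m) ℝ) : Prop :=
  ∀ r : ℕ, 1 ≤ r → ∀ P : Matrix (Fin n × Fin r) (Fin n × Fin r) ℝ, P.PosSemidef →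
    tensorId Φ r P ∈ SEP m r

/-- The Choi–Effros product `A ⋆ B = Ψ(AB)` on the range of `Ψ`. -/
def choiEffrosMul {n : ℕ} (Ψ : Matrix (Fin n) (Fin n) ℝ →ₗ[ℝ] Matrix (Fin n) (Fin n) ℝ)
    (A B : LinearMap.range Ψ) : LinearMap.range Ψ :=
  ⟨Ψ ((A : Matrix (Fin n) (Fin n) ℝ) * (B : Matrix (Fin n) (Fin n) ℝ)), LinearMap.mem_range_self Ψ _⟩

/-- The linear bijection `θ` identifies the operator system `Ψ(M_n(ℝ))`, equipped with the
Choi–Effros product, with the ordered `*`-algebra `ℓ^∞_k(ℝ)` (that is `ℝ^k` with the pointwise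
operations and order): it respects the unit `I_n`, the product, the adjoint, the order, and the order
at every matrix level. -/
structure IsOrderIsoToLInfty {n : ℕ}
    (Ψ : Matrix (Fin n) (Fin n) ℝ →ₗ[ℝ] Matrix (Fin n) (Fin n) ℝ) {k : ℕ}
    (θ : LinearMap.range Ψ ≃ₗ[ℝ] (Fin k → ℝ)) : Prop where
  map_one : ∃ e : LinearMap.range Ψ, (e : Matrix (Fin n) (Fin n) ℝ) = 1 ∧ θ e = 1
  map_mul : ∀ A B : LinearMap.range Ψ, θ (choiEffrosMul Ψ A B) = θ A * θ B
  map_star : ∀ A : LinearMap.range Ψ, ∃ B : LinearMap.range Ψ,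
    (B : Matrix (Fin n) (Fin n) ℝ) = (A : Matrix (Fin n) (Fin n) ℝ).transpose ∧ θ B = star (θ A)
  order_iff : ∀ A : LinearMap.range Ψ,
    (A : Matrix (Fin n) (Fin n) ℝ).PosSemidef ↔ 0 ≤ θ A
  matrix_order_iff : ∀ (r : ℕ) (X : Matrix (Fin r) (Fin r) (LinearMap.range Ψ)),
    (Matrix.of fun (x y : Fin r × Fin n) =>
        (X x.1 y.1 : Matrix (Fin n) (Fin n) ℝ) x.2 y.2).PosSemidef ↔
      ∀ l : Fin k, (Matrix.of fun i j => θ (X i j) l).PosSemidef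

end RealQuantum

open Matrix

/-! Invariance of the Choi matrix under partial transpose means `Ψ Aᵀ = Ψ A`. Since `Ψ` also
commutes with the transpose, its range consists of symmetric matrices, and there `A ⋆ B = Ψ(AB) =
Ψ((AB)ᵀ) = B ⋆ A`. Kadison–Schwarz makes `⋆` associative (through `IsIPTMap.map_mul_map`) and
formally real, so the range is a finite-dimensional commutative formally real algebra, that is,
`ℝ^k`.

The coordinate idempotents `e_l` are positive semidefinite because `e_l = Ψ(e_lᵀ e_l)`, and
compressing by them shows that coordinates of positive elements are nonnegative. Expanding in the
`e_l` then gives the order isomorphism at every matrix level (`matrix_posSemidef_iff`) and writes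
`(Ψ ⊗ id)(P)` as `∑ e_l ⊗ B_l` with `B_l` positive semidefinite. -/

/-- A finite-dimensional formally real commutative `ℝ`-algebra is isomorphic to some `ℝ^k`. -/
theorem exists_algEquiv_pi_real_of_formallyReal (A : Type*) [CommRing A] [Algebra ℝ A]
    [FiniteDimensional ℝ A] (h : ∀ x y : A, x * x + y * y = 0 → x = 0) :
    ∃ k : ℕ, Nonempty (A ≃ₐ[ℝ] (Fin k → ℝ)) := by
  classical
  have : IsArtinianRing A := IsArtinianRing.of_finite ℝ A
  have : IsReduced A := by
    rw [isReduced_iff_pow_one_lt 2 one_lt_two]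
    intro x hx
    exact h x 0 (by simpa [sq] using hx)
  let E := IsArtinianRing.equivPi A
  have key : ∀ m : MaximalSpectrum A, Nonempty ((A ⧸ m.asIdeal) ≃ₐ[ℝ] ℝ) := by
    intro m
    have := m.isMaximal
    let : Field (A ⧸ m.asIdeal) := Ideal.Quotient.field m.asIdeal
    have : Algebra.IsAlgebraic ℝ (A ⧸ m.asIdeal) := Algebra.IsAlgebraic.of_finite ℝ _
    rcases Real.nonempty_algEquiv_or (A ⧸ m.asIdeal) with h1 | ⟨⟨f⟩⟩
    · exact h1
    · exfalso
      -- A complex residue field would contain a square root of `-1`; placed in that factor of the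
      -- product, it gives `1² + i² = 0`, against formal reality.
      have hI : f.symm Complex.I * f.symm Complex.I = -1 := by
        rw [← map_mul, Complex.I_mul_I, map_neg, map_one]
      have h0 : E.symm (Pi.single m 1) = 0 := by
        refine h _ (E.symm (Pi.single m (f.symm Complex.I))) ?_
        rw [← map_mul, ← map_mul, ← map_add, ← Pi.single_mul, ← Pi.single_mul, ← Pi.single_add,
          hI, one_mul, add_neg_cancel, Pi.single_zero, map_zero]
      have h1 := (map_eq_zero_iff E.symm E.symm.injective).1 h0
      have h2 := congrFun h1 m
      rw [Pi.single_eq_same] at h2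
      exact one_ne_zero h2
  let F : A ≃ₐ[ℝ] (MaximalSpectrum A → ℝ) :=
    (E.restrictScalars ℝ).trans (AlgEquiv.piCongrRight fun m => (key m).some)
  exact ⟨Nat.card (MaximalSpectrum A),
    ⟨F.trans (AlgEquiv.piCongrLeft ℝ (fun _ => ℝ) (Finite.equivFin (MaximalSpectrum A)))⟩⟩

namespace RealQuantum

/-! ### Completely positive and IPT maps -/

section Maps

variable {n m : ℕ} {Φ : Matrix (Fin n) (Fin n) ℝ →ₗ[ℝ] Matrix (Fin m) (Fin m) ℝ}

theorem tensorId_apply (r : ℕ) (P : Matrix (Fin n × Fin r) (Fin n × Fin r) ℝ)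
    (x y : Fin m × Fin r) :
    tensorId Φ r P x y = Φ (Matrix.of fun a b => P (a, x.2) (b, y.2)) x.1 y.1 := rfl

theorem IsCompletelyPositive.map_transpose (hΦ : IsCompletelyPositive Φ)
    (A : Matrix (Fin n) (Fin n) ℝ) : Φ Aᵀ = (Φ A)ᵀ := by
  ext a b
  exact congrFun (congrFun ((hΦ 1).2 (Matrix.of fun x y => A x.1 y.1)) (a, 0)) (b, 0)

theorem IsCompletelyPositive.posSemidef_map (hΦ : IsCompletelyPositive Φ)
    {A : Matrix (Fin n) (Fin n) ℝ} (hA : A.PosSemidef) : (Φ A).PosSemidef :=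
  ((hΦ 1).1 _ (hA.submatrix fun x : Fin n × Fin 1 => x.1)).submatrix
    fun a : Fin m => (a, (0 : Fin 1))

/-- The Kadison–Schwarz inequality. -/
theorem IsCompletelyPositive.posSemidef_schwarz
    (hΦ : IsCompletelyPositive Φ) (h1 : Φ 1 = 1) (Z : Matrix (Fin n) (Fin n) ℝ) :
    (Φ (Zᵀ * Z) - (Φ Z)ᵀ * Φ Z).PosSemidef := by
  -- `Q` is the block row `[1, Z]`, so `Qᴴ * Q` has blocks `1`, `Z`, `Zᵀ`, `Zᵀ * Z`.
  let Q : Matrix (Fin n) (Fin n × Fin 2) ℝ :=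
    Matrix.of fun a x => (![1, Z] : Fin 2 → Matrix (Fin n) (Fin n) ℝ) x.2 a x.1
  have hQ : (tensorId Φ 2 (Qᴴ * Q)).PosSemidef :=
    (hΦ 2).1 _ (posSemidef_conjTranspose_mul_self Q)
  have hb : ∀ i j : Fin 2, (Matrix.of fun a b => (Qᴴ * Q) (a, i) (b, j)) =
      ((![1, Z] : Fin 2 → Matrix (Fin n) (Fin n) ℝ) i)ᵀ * (![1, Z] : Fin 2 → _) j := by
    intro i j
    ext a b
    simp [Matrix.mul_apply, Q]
  refine .of_dotProduct_mulVec_nonneg ?_ fun v => ?_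
  · rw [IsHermitian, conjTranspose_eq_transpose_of_trivial, transpose_sub, ← hΦ.map_transpose,
      transpose_mul, transpose_mul, transpose_transpose, transpose_transpose]
  -- Schur complement: this vector kills the first block row of the image, leaving exactly the
  -- quadratic form of the Schwarz defect at `v`.
  · let w : Fin m × Fin 2 → ℝ := fun x => ![-(Φ Z *ᵥ v), v] x.2 x.1
    have hw := hQ.dotProduct_mulVec_nonneg w
    have hM : ∀ x y, tensorId Φ 2 (Qᴴ * Q) x y =
        Φ (((![1, Z] : Fin 2 → Matrix (Fin n) (Fin n) ℝ) x.2)ᵀ * (![1, Z] : Fin 2 → _) y.2)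
          x.1 y.1 := fun x y => by rw [tensorId_apply, hb]
    have hmv : ∀ x, (tensorId Φ 2 (Qᴴ * Q) *ᵥ w) x =
        ![0, (Φ (Zᵀ * Z) - (Φ Z)ᵀ * Φ Z) *ᵥ v] x.2 x.1 := by
      rintro ⟨a, i⟩
      have : (tensorId Φ 2 (Qᴴ * Q) *ᵥ w) (a, i) =
          (Φ (((![1, Z] : Fin 2 → Matrix (Fin n) (Fin n) ℝ) i)ᵀ * 1) *ᵥ (-(Φ Z *ᵥ v)) +
          Φ (((![1, Z] : Fin 2 → Matrix (Fin n) (Fin n) ℝ) i)ᵀ * Z) *ᵥ v) a := by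
        simp only [mulVec, dotProduct, Fintype.sum_prod_type_right, Fin.sum_univ_two, hM, w,
          Pi.add_apply]
        simp
      rw [this]
      fin_cases i
      · simp [h1]
      · simp [hΦ.map_transpose, sub_mulVec, mulVec_neg]
        ring
    have : star w ⬝ᵥ (tensorId Φ 2 (Qᴴ * Q) *ᵥ w) =
        star v ⬝ᵥ ((Φ (Zᵀ * Z) - (Φ Z)ᵀ * Φ Z) *ᵥ v) := by
      simp only [dotProduct, Fintype.sum_prod_type_right, Fin.sum_univ_two, hmv]
      simp [w]
    rwa [this] at hw

theorem choiMatrix_apply (x y : Fin n × Fin m) :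
    choiMatrix Φ x y = Φ (Matrix.single x.1 y.1 1) x.2 y.2 := by
  simp only [choiMatrix, Matrix.sum_apply, kroneckerMap_apply, Matrix.single_apply]
  rw [Finset.sum_eq_single x.1, Finset.sum_eq_single y.1]
  · simp
  · intro b _ hb; simp [hb]
  · simp
  · intro b _ hb; simp [hb]
  · simp

/-- The blocks of the Choi matrix are the `Φ(E_ij)`, and partial transpose swaps blocks `(i, j)` and
`(j, i)`. -/
theorem IsIPTMap.map_transpose_eq (hΦ : IsIPTMap Φ) (A : Matrix (Fin n) (Fin n) ℝ) :
    Φ Aᵀ = Φ A := by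
  have hs : ∀ i j, Φ (Matrix.single j i 1) = Φ (Matrix.single i j 1) := by
    intro i j
    ext a b
    have h := congrFun (congrFun hΦ.2.2 (i, a)) (j, b)
    rw [choiMatrix_apply, partialTranspose, tensorId_apply] at h
    simpa [choiMatrix_apply] using h
  have h : Φ ∘ₗ (Matrix.transposeLinearEquiv (Fin n) (Fin n) ℝ ℝ).toLinearMap = Φ := by
    refine Matrix.ext_linearMap _ fun i j => ?_
    ext
    simp [hs]
  exact LinearMap.congr_fun h A

theorem IsIPTMap.isSymm_map (hΦ : IsIPTMap Φ) (A : Matrix (Fin n) (Fin n) ℝ) :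
    (Φ A)ᵀ = Φ A := by
  rw [← hΦ.1.map_transpose, hΦ.map_transpose_eq]

end Maps

theorem eq_of_isSymm_of_dotProduct_mulVec {ι : Type*} [Fintype ι] {A B : Matrix ι ι ℝ}
    (hA : Aᵀ = A) (hB : Bᵀ = B) (h : ∀ v : ι → ℝ, v ⬝ᵥ A *ᵥ v = v ⬝ᵥ B *ᵥ v) : A = B := by
  classical
  have hC : ∀ v : ι → ℝ, v ⬝ᵥ (A - B) *ᵥ v = 0 := fun v => by
    rw [sub_mulVec, dotProduct_sub, h, sub_self]
  have hS : ∀ i j, (A - B) j i = (A - B) i j := fun i j =>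
    congrFun (congrFun (show (A - B)ᵀ = A - B by rw [transpose_sub, hA, hB]) i) j
  rw [← sub_eq_zero]
  ext i j
  have h1 := hC (Pi.single i 1 + Pi.single j 1)
  have h2 := hC (Pi.single i 1)
  have h3 := hC (Pi.single j 1)
  have h4 := hS i j
  simp only [mulVec_add, dotProduct_add, add_dotProduct, mulVec_single_one,
    single_one_dotProduct, col_apply] at h1 h2 h3
  rw [Matrix.zero_apply]
  linarith

/-! ### The Choi–Effros algebra of an idempotent IPT map -/

section Idempotent

variable {n : ℕ} {Ψ : Matrix (Fin n) (Fin n) ℝ →ₗ[ℝ] Matrix (Fin n) (Fin n) ℝ}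

/-- The Choi–Effros identity: `Ψ` is a conditional expectation for the Choi–Effros product. -/
theorem IsIPTMap.map_mul_map (hΨ : IsIPTMap Ψ) (h1 : Ψ 1 = 1) (hi : ∀ A, Ψ (Ψ A) = Ψ A)
    (X Y : Matrix (Fin n) (Fin n) ℝ) : Ψ (Ψ X * Ψ Y) = Ψ (Ψ X * Y) := by
  rw [← sub_eq_zero, ← map_sub, ← mul_sub]
  set W := Ψ Y - Y with hW
  have hW0 : Ψ W = 0 := by rw [hW, map_sub, hi, sub_self]
  have hsym := hΨ.isSymm_map X
  refine eq_of_isSymm_of_dotProduct_mulVec (hΨ.isSymm_map _) transpose_zero fun v => ?_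
  rw [zero_mulVec, dotProduct_zero]
  have hcomm : Ψ (Wᵀ * Ψ X) = Ψ (Ψ X * W) := by
    rw [← hΨ.map_transpose_eq, transpose_mul, transpose_transpose, hsym]
  -- Apply `Ψ` to the Schwarz inequality at `Ψ X + t W`. As `Ψ W = 0`, the constant terms cancel; a
  -- polynomial `2at + bt²` that is nonnegative for all `t` must have `a = 0`.
  have hq : ∀ t : ℝ, 0 ≤ v ⬝ᵥ Ψ (Ψ X * W) *ᵥ v * (2 * t) + v ⬝ᵥ Ψ (Wᵀ * W) *ᵥ v * t ^ 2 := by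
    intro t
    have hS := hΨ.1.posSemidef_schwarz h1 (Ψ X + t • W)
    have hΨ2 := (hΨ.1.posSemidef_map hS).dotProduct_mulVec_nonneg v
    have e : Ψ (Ψ ((Ψ X + t • W)ᵀ * (Ψ X + t • W)) - (Ψ (Ψ X + t • W))ᵀ * Ψ (Ψ X + t • W)) =
        (2 * t) • Ψ (Ψ X * W) + (t ^ 2) • Ψ (Wᵀ * W) := by
      simp only [transpose_add, transpose_smul, map_add, map_smul, map_sub, hW0, hi, hsym,
        smul_zero, add_zero, add_mul, mul_add, smul_mul_assoc, mul_smul_comm, hcomm]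
      module
    rw [e] at hΨ2
    simp only [add_mulVec, smul_mulVec, dotProduct_add, dotProduct_smul, smul_eq_mul,
      star_trivial] at hΨ2
    linarith
  set a := v ⬝ᵥ Ψ (Ψ X * W) *ᵥ v
  set b := v ⬝ᵥ Ψ (Wᵀ * W) *ᵥ v
  have hb : 0 ≤ b := by
    have := (hΨ.1.posSemidef_map (posSemidef_conjTranspose_mul_self W)).dotProduct_mulVec_nonneg v
    simpa [b, conjTranspose_eq_transpose_of_trivial] using this
  -- The minimizer would be `-a / b`; `b + 1` avoids dividing by zero.
  have h2 := hq (-a / (b + 1))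
  have h3 : a * (2 * (-a / (b + 1))) + b * (-a / (b + 1)) ^ 2 =
      -(a ^ 2 * (b + 2)) / (b + 1) ^ 2 := by
    field_simp
    ring
  rw [h3] at h2
  have h4 : 0 ≤ -(a ^ 2 * (b + 2)) := by
    by_contra! hneg
    exact absurd h2 (not_le.2 (div_neg_of_neg_of_pos hneg (by positivity)))
  have h5 : a ^ 2 * (b + 2) = 0 := le_antisymm (by linarith) (by positivity)
  rcases mul_eq_zero.1 h5 with h | h
  · exact pow_eq_zero_iff two_ne_zero |>.1 h
  · linarith

theorem IsIPTMap.map_mul_comm (hΨ : IsIPTMap Ψ) (X Y : Matrix (Fin n) (Fin n) ℝ) :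
    Ψ (Ψ X * Ψ Y) = Ψ (Ψ Y * Ψ X) := by
  rw [← hΨ.map_transpose_eq, transpose_mul, hΨ.isSymm_map, hΨ.isSymm_map]

theorem IsIPTMap.map_map_mul (hΨ : IsIPTMap Ψ) (h1 : Ψ 1 = 1) (hi : ∀ A, Ψ (Ψ A) = Ψ A)
    (X Y : Matrix (Fin n) (Fin n) ℝ) : Ψ (Ψ X * Ψ Y) = Ψ (X * Ψ Y) := by
  rw [hΨ.map_mul_comm, ← hΨ.map_transpose_eq X, hΨ.map_mul_map h1 hi, ← hΨ.map_transpose_eq,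
    transpose_mul, transpose_transpose, hΨ.isSymm_map]

theorem eq_zero_of_posSemidef_neg_mul_self {ι : Type*} [Fintype ι] {S : Matrix ι ι ℝ}
    (hS : Sᵀ = S) (h : (-(S * S)).PosSemidef) : S = 0 := by
  have h0 : (Sᴴ * S) = 0 := by
    have hp := posSemidef_conjTranspose_mul_self S
    rw [conjTranspose_eq_transpose_of_trivial, hS] at hp ⊢
    refine eq_of_isSymm_of_dotProduct_mulVec (by rw [transpose_mul, hS]) transpose_zero
      fun v => ?_
    have h1 := hp.dotProduct_mulVec_nonneg v
    have h2 := h.dotProduct_mulVec_nonneg v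
    simp only [neg_mulVec, dotProduct_neg, star_trivial] at h1 h2
    rw [zero_mulVec, dotProduct_zero]
    linarith
  exact conjTranspose_mul_self_eq_zero.1 h0

theorem map_coe_range (hi : ∀ A, Ψ (Ψ A) = Ψ A) (A : LinearMap.range Ψ) :
    Ψ (A : Matrix (Fin n) (Fin n) ℝ) = A := by
  obtain ⟨A, X, rfl⟩ := A
  exact hi X

/-- The range of a unital idempotent IPT map is a commutative ring for the Choi–Effros product. -/
abbrev choiEffrosCommRing (hΨ : IsIPTMap Ψ) (h1 : Ψ 1 = 1) (hi : ∀ A, Ψ (Ψ A) = Ψ A) :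
    CommRing (LinearMap.range Ψ) :=
  { (inferInstance : AddCommGroup (LinearMap.range Ψ)) with
    mul := choiEffrosMul Ψ
    one := ⟨1, 1, h1⟩
    left_distrib := fun A B C => Subtype.ext <| by
      change Ψ (A.1 * (B.1 + C.1)) = Ψ (A.1 * B.1) + Ψ (A.1 * C.1)
      rw [mul_add, map_add]
    right_distrib := fun A B C => Subtype.ext <| by
      change Ψ ((A.1 + B.1) * C.1) = Ψ (A.1 * C.1) + Ψ (B.1 * C.1)
      rw [add_mul, map_add]
    zero_mul := fun A => Subtype.ext <| by
      change Ψ (0 * A.1) = 0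
      rw [zero_mul, map_zero]
    mul_zero := fun A => Subtype.ext <| by
      change Ψ (A.1 * 0) = 0
      rw [mul_zero, map_zero]
    one_mul := fun A => Subtype.ext <| by
      change Ψ (1 * A.1) = A.1
      rw [one_mul, map_coe_range hi]
    mul_one := fun A => Subtype.ext <| by
      change Ψ (A.1 * 1) = A.1
      rw [mul_one, map_coe_range hi]
    mul_assoc := fun A B C => Subtype.ext <| by
      change Ψ (Ψ (A.1 * B.1) * C.1) = Ψ (A.1 * Ψ (B.1 * C.1))
      -- Both sides reduce to `Ψ` of the ordinary triple product.
      rw [← map_coe_range hi C, hΨ.map_map_mul h1 hi, ← map_coe_range hi A, hΨ.map_mul_map h1 hi,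
        mul_assoc]
    mul_comm := fun A B => Subtype.ext <| by
      change Ψ (A.1 * B.1) = Ψ (B.1 * A.1)
      rw [← map_coe_range hi A, ← map_coe_range hi B, hΨ.map_mul_comm] }

/-- The range of a unital idempotent IPT map, with the Choi–Effros product, is some `ℝ^k`. -/
theorem exists_linearEquiv_pi_real (hΨ : IsIPTMap Ψ) (h1 : Ψ 1 = 1) (hi : ∀ A, Ψ (Ψ A) = Ψ A) :
    ∃ (k : ℕ) (θ : LinearMap.range Ψ ≃ₗ[ℝ] (Fin k → ℝ)), θ ⟨1, 1, h1⟩ = 1 ∧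
      ∀ A B, θ (choiEffrosMul Ψ A B) = θ A * θ B := by
  let := choiEffrosCommRing hΨ h1 hi
  let : Algebra ℝ (LinearMap.range Ψ) := Algebra.ofModule
    (fun c A B => Subtype.ext <| by
      change Ψ ((c • A.1) * B.1) = c • Ψ (A.1 * B.1)
      rw [smul_mul_assoc, map_smul])
    (fun c A B => Subtype.ext <| by
      change Ψ (A.1 * (c • B.1)) = c • Ψ (A.1 * B.1)
      rw [mul_smul_comm, map_smul])
  have hreal : ∀ x y : LinearMap.range Ψ, x * x + y * y = 0 → x = 0 := by
    intro x y hxy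
    have hxy' : Ψ (x.1 * x.1) + Ψ (y.1 * y.1) = 0 := congrArg Subtype.val hxy
    have hs : ∀ z : LinearMap.range Ψ, z.1ᵀ = z.1 := fun z => by
      rw [← map_coe_range hi z, hΨ.isSymm_map]
    refine Subtype.ext (eq_zero_of_posSemidef_neg_mul_self (hs x) ?_)
    -- `x² ≤ Ψ(x²) = -Ψ(y²) ≤ 0`.
    have hx := hΨ.1.posSemidef_schwarz h1 x.1
    have hy := hΨ.1.posSemidef_map (posSemidef_conjTranspose_mul_self y.1)
    rw [conjTranspose_eq_transpose_of_trivial, hs] at hy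
    rw [map_coe_range hi, hs] at hx
    have := hx.add hy
    rwa [sub_add_eq_add_sub, hxy', zero_sub] at this
  obtain ⟨k, ⟨θ⟩⟩ := exists_algEquiv_pi_real_of_formallyReal (LinearMap.range Ψ) hreal
  exact ⟨k, θ.toLinearEquiv, map_one θ, fun A B => map_mul θ A B⟩

/-! ### Positivity in coordinates and separability -/

section Coordinates

variable {k : ℕ} {θ : LinearMap.range Ψ ≃ₗ[ℝ] (Fin k → ℝ)}

theorem coe_eq_sum_single (A : LinearMap.range Ψ) :
    (A : Matrix (Fin n) (Fin n) ℝ) =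
      ∑ l, θ A l • (θ.symm (Pi.single l 1) : Matrix (Fin n) (Fin n) ℝ) := by
  have h : A = ∑ l, θ A l • θ.symm (Pi.single l 1) := by
    apply θ.injective
    ext i
    simp [Finset.sum_apply, Pi.single_apply]
  conv_lhs => rw [h]
  simp

theorem posSemidef_single (hΨ : IsIPTMap Ψ) (hi : ∀ A, Ψ (Ψ A) = Ψ A)
    (hθ : ∀ A B, θ (choiEffrosMul Ψ A B) = θ A * θ B) (l : Fin k) :
    (θ.symm (Pi.single l 1) : Matrix (Fin n) (Fin n) ℝ).PosSemidef := by
  set e := θ.symm (Pi.single l 1) with he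
  have h : choiEffrosMul Ψ e e = e := by
    apply θ.injective
    rw [hθ, he, LinearEquiv.apply_symm_apply, ← Pi.single_mul, one_mul]
  have h' : Ψ (e.1 * e.1) = e.1 := congrArg Subtype.val h
  have hp := hΨ.1.posSemidef_map (posSemidef_conjTranspose_mul_self e.1)
  rw [conjTranspose_eq_transpose_of_trivial] at hp
  rwa [show e.1ᵀ = e.1 by rw [← map_coe_range hi e, hΨ.isSymm_map], h'] at hp

/-- Compression by the idempotent `e` gives `Ψ(e A e) = θ(A)_l e`, which is positive semidefinite
along with `e`; a negative coefficient would force `e = 0`. -/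
theorem apply_nonneg_of_posSemidef (hΨ : IsIPTMap Ψ) (h1 : Ψ 1 = 1) (hi : ∀ A, Ψ (Ψ A) = Ψ A)
    (hθ : ∀ A B, θ (choiEffrosMul Ψ A B) = θ A * θ B) {A : LinearMap.range Ψ}
    (hA : (A : Matrix (Fin n) (Fin n) ℝ).PosSemidef) (l : Fin k) : 0 ≤ θ A l := by
  have hp := posSemidef_single hΨ hi hθ l
  set e := θ.symm (Pi.single l 1) with he
  have hs : e.1ᵀ = e.1 := by rw [← map_coe_range hi e, hΨ.isSymm_map]
  have h : choiEffrosMul Ψ (choiEffrosMul Ψ e A) e = θ A l • e := by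
    apply θ.injective
    rw [hθ, hθ, map_smul, he, LinearEquiv.apply_symm_apply]
    ext i
    by_cases hil : i = l
    · subst hil; simp
    · simp [hil]
  have h' : Ψ (e.1 * A.1 * e.1) = θ A l • e.1 := by
    have h2 : Ψ (Ψ (e.1 * A.1) * e.1) = θ A l • e.1 := congrArg Subtype.val h
    have h3 := hΨ.map_map_mul h1 hi (e.1 * A.1) e.1
    rw [map_coe_range hi e] at h3
    rwa [h3] at h2
  have hpos := hΨ.1.posSemidef_map (hA.conjTranspose_mul_mul_same e.1)
  rw [conjTranspose_eq_transpose_of_trivial, hs, h'] at hpos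
  by_contra! hneg
  have hz : e.1 = 0 := by
    refine eq_of_isSymm_of_dotProduct_mulVec hs transpose_zero fun v => ?_
    have ha := hp.dotProduct_mulVec_nonneg v
    have hb := hpos.dotProduct_mulVec_nonneg v
    simp only [smul_mulVec, dotProduct_smul, smul_eq_mul, star_trivial] at ha hb
    rw [zero_mulVec, dotProduct_zero]
    nlinarith
  have h0 : θ e = 0 := by rw [show e = 0 from Subtype.ext hz, map_zero]
  rw [he, LinearEquiv.apply_symm_apply] at h0
  simpa using congrFun h0 l

theorem posSemidef_iff_apply_nonneg (hΨ : IsIPTMap Ψ) (h1 : Ψ 1 = 1) (hi : ∀ A, Ψ (Ψ A) = Ψ A)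
    (hθ : ∀ A B, θ (choiEffrosMul Ψ A B) = θ A * θ B) (A : LinearMap.range Ψ) :
    (A : Matrix (Fin n) (Fin n) ℝ).PosSemidef ↔ 0 ≤ θ A := by
  refine ⟨fun hA l => apply_nonneg_of_posSemidef hΨ h1 hi hθ hA l, fun hA => ?_⟩
  rw [coe_eq_sum_single (θ := θ) A]
  exact posSemidef_sum _ fun l _ => (posSemidef_single hΨ hi hθ l).smul (hA l)

/-- Forward, contracting with a scalar vector `c` reduces to the level-one statement for `∑ c_i c_j
X_ij`. Backward, `X = ∑ θ_l(X) ⊗ e_l` is a sum of Kronecker products of positive semidefinite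
matrices. -/
theorem matrix_posSemidef_iff (hΨ : IsIPTMap Ψ) (h1 : Ψ 1 = 1) (hi : ∀ A, Ψ (Ψ A) = Ψ A)
    (hθ : ∀ A B, θ (choiEffrosMul Ψ A B) = θ A * θ B) (r : ℕ)
    (X : Matrix (Fin r) (Fin r) (LinearMap.range Ψ)) :
    (Matrix.of fun (x y : Fin r × Fin n) =>
        (X x.1 y.1 : Matrix (Fin n) (Fin n) ℝ) x.2 y.2).PosSemidef ↔
      ∀ l : Fin k, (Matrix.of fun i j => θ (X i j) l).PosSemidef := by
  constructor
  · intro h l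
    have hX : ∀ i j, X j i = X i j := fun i j => Subtype.ext <| by
      ext a b
      have h2 := congrFun (congrFun h.1 (i, a)) (j, b)
      simp only [conjTranspose_apply, of_apply, star_trivial] at h2
      rw [← h2, ← transpose_apply (X j i).1, ← map_coe_range hi (X j i), hΨ.isSymm_map]
    refine .of_dotProduct_mulVec_nonneg (by ext i j; simp [hX i j]) fun c => ?_
    have hsum : (∑ i, ∑ j, (c i * c j) • (X i j) : LinearMap.range Ψ).1.PosSemidef := by
      refine .of_dotProduct_mulVec_nonneg ?_ fun v => ?_
      · rw [IsHermitian, conjTranspose_eq_transpose_of_trivial, ← map_coe_range hi,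
          hΨ.isSymm_map]
      · have hv := h.dotProduct_mulVec_nonneg fun x => c x.1 * v x.2
        refine hv.trans_eq ?_
        simp only [Submodule.coe_sum, Submodule.coe_smul, sum_mulVec, dotProduct_sum, smul_mulVec,
          dotProduct_smul, smul_eq_mul, star_trivial]
        simp only [dotProduct, mulVec, Fintype.sum_prod_type, of_apply,
          Finset.mul_sum]
        refine Finset.sum_congr rfl fun i _ => ?_
        rw [Finset.sum_comm]
        refine Finset.sum_congr rfl fun j _ => Finset.sum_congr rfl fun a _ =>
          Finset.sum_congr rfl fun b _ => ?_
        ring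
    have h3 := apply_nonneg_of_posSemidef hΨ h1 hi hθ hsum l
    refine h3.trans_eq ?_
    simp only [map_sum, map_smul, Finset.sum_apply, Pi.smul_apply, smul_eq_mul, dotProduct, mulVec,
      star_trivial, of_apply, Finset.mul_sum]
    exact Finset.sum_congr rfl fun i _ => Finset.sum_congr rfl fun j _ => by ring
  · intro h
    have e : (Matrix.of fun (x y : Fin r × Fin n) =>
        (X x.1 y.1 : Matrix (Fin n) (Fin n) ℝ) x.2 y.2) =
        ∑ l, (Matrix.of fun i j => θ (X i j) l) ⊗ₖ (θ.symm (Pi.single l 1)).1 := by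
      ext x y
      rw [of_apply, coe_eq_sum_single (θ := θ) (X x.1 y.1)]
      simp [Matrix.sum_apply]
    rw [e]
    exact posSemidef_sum _ fun l _ => (h l).kronecker (posSemidef_single hΨ hi hθ l)

theorem isOrderIsoToLInfty (hΨ : IsIPTMap Ψ) (h1 : Ψ 1 = 1) (hi : ∀ A, Ψ (Ψ A) = Ψ A)
    (hθ1 : θ ⟨1, 1, h1⟩ = 1) (hθ : ∀ A B, θ (choiEffrosMul Ψ A B) = θ A * θ B) :
    IsOrderIsoToLInfty Ψ θ where
  map_one := ⟨_, rfl, hθ1⟩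
  map_mul := hθ
  map_star A := ⟨A, by rw [← map_coe_range hi A, hΨ.isSymm_map], (star_trivial _).symm⟩
  order_iff := posSemidef_iff_apply_nonneg hΨ h1 hi hθ
  matrix_order_iff := matrix_posSemidef_iff hΨ h1 hi hθ

theorem isEntanglementBreaking (hΨ : IsIPTMap Ψ) (h1 : Ψ 1 = 1) (hi : ∀ A, Ψ (Ψ A) = Ψ A)
    (hθ : ∀ A B, θ (choiEffrosMul Ψ A B) = θ A * θ B) : IsEntanglementBreaking Ψ := by
  intro r _ P hP
  let X : Matrix (Fin r) (Fin r) (LinearMap.range Ψ) := Matrix.of fun i j =>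
    ⟨Ψ (Matrix.of fun a b => P (a, i) (b, j)), LinearMap.mem_range_self Ψ _⟩
  -- The swap is needed because `tensorId` puts the `Fin r` index second, while the matrix order
  -- puts it first.
  have hX := (matrix_posSemidef_iff hΨ h1 hi hθ r X).1
    (((hΨ.1 r).1 P hP).submatrix Prod.swap)
  refine ⟨k, fun l => (θ.symm (Pi.single l 1)).1, fun l => Matrix.of fun i j => θ (X i j) l,
    posSemidef_single hΨ hi hθ, hX, ?_⟩
  ext x y
  change (X x.2 y.2).1 x.1 y.1 = _
  rw [coe_eq_sum_single (θ := θ) (X x.2 y.2)]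
  simp [Matrix.sum_apply, mul_comm]

end Coordinates

end Idempotent

end RealQuantum

theorem mainTheorem5 (n : ℕ) (hn : 1 ≤ n)
    (Ψ : Matrix (Fin n) (Fin n) ℝ →ₗ[ℝ] Matrix (Fin n) (Fin n) ℝ)
    (hunital : Ψ 1 = 1)
    (hIPT : RealQuantum.IsIPTMap Ψ)
    (hidem : Ψ ∘ₗ Ψ = Ψ) :
    (∃ k : ℕ, 1 ≤ k ∧ ∃ θ : LinearMap.range Ψ ≃ₗ[ℝ] (Fin k → ℝ),
      RealQuantum.IsOrderIsoToLInfty Ψ θ) ∧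
    RealQuantum.IsEntanglementBreaking Ψ := by
  have hi : ∀ A, Ψ (Ψ A) = Ψ A := LinearMap.congr_fun hidem
  obtain ⟨k, θ, hθ1, hθ⟩ := RealQuantum.exists_linearEquiv_pi_real hIPT hunital hi
  refine ⟨⟨k, Nat.one_le_iff_ne_zero.2 ?_, θ,
    RealQuantum.isOrderIsoToLInfty hIPT hunital hi hθ1 hθ⟩,
    RealQuantum.isEntanglementBreaking hIPT hunital hi hθ⟩
  -- If `k = 0` the range would be trivial, yet it contains `1 ≠ 0` since `n ≥ 1`.
  rintro rfl
  have h : (⟨1, 1, hunital⟩ : LinearMap.range Ψ) = 0 := θ.injective (Subsingleton.elim _ _)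
  have h' : (1 : Matrix (Fin n) (Fin n) ℝ) = 0 := congrArg Subtype.val h
  have : Nonempty (Fin n) := ⟨⟨0, hn⟩⟩
  exact one_ne_zero h'
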